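/- Let $\mathscr H$ be a complex Hilbert space, and let $T$ be a locally compact Hausdorff space with a bounded Radon measure $\mu$. Suppose $T=T_1\sqcup T_2$ is the union of two disjoint subsets that are locally compact in the subspace topology. Let $J\subseteq\mathbb R$ be an interval and let $f$ be operator convex on $J$, i.e. $f$ is continuous on $J$ and $f(\lambda X+(1-\lambda)Y)\le\lambda f(X)+(1-\lambda)f(Y)$ for all $\lambda\in[0,1]$ and all bounded self-adjoint operators $X,Y$ with spectra in $J$ on an arbitrary complex Hilbert space. The perspective function of $f$ is $$g(L,R)=R^{1/2}f\bigl(R^{-1/2}LR^{-1/2}\bigr)R^{1/2},$$ defined for bounded operators $L=L^*$ and $R$ positive and invertible such that $R^{-1/2}LR^{-1/2}$ has its spectrum in $J$; put also $g(0,0)=0$. Let $\widetilde A=(A_t)_{t\in T}$ and $\widetilde B=(B_t)_{t\in T}$ be norm continuous fields of bounded operators on $\mathscr H$ such that, for every $t\in T$, $A_t$ is self-adjoint, $B_t$ is positive and invertible, and $B_t^{-1/2}A_tB_t^{-1/2}$ has its spectrum in $J$. Assume that $t\mapsto A_t$, $t\mapsto B_t$ and $t\mapsto g(A_t,B_t)$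 are (Bochner) integrable on $T$, and put $$\Theta(\widetilde A,\widetilde B)=\int_T g(A_t,B_t)\,d\mu(t),\quad A=\int_T A_t\,d\mu(t),\quad B=\int_T B_t\,d\mu(t),\quad A_{T_i}=\int_{T_i}A_t\,d\mu(t),\quad B_{T_i}=\int_{T_i}B_t\,d\mu(t)\quad(i=1,2).$$ Then for each $S\in\{T_1,T_2,T\}$ with $\mu(S)\neq0$ the pair $\bigl(\int_SA_t\,d\mu(t),\int_SB_t\,d\mu(t)\bigr)$ lies in the domain of $g$ (and it is $(0,0)$ if $\mu(S)=0$), and $$2\,g\Bigl(\tfrac12A,\tfrac12B\Bigr)\;\le\;g(A_{T_1},B_{T_1})+g(A_{T_2},B_{T_2})\;\le\;\Theta(\widetilde A,\widetilde B).$$ -/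

import Mathlib

open MeasureTheory

universe u v

noncomputable section

/-- A real function `f` is operator convex on the interval `J` if it is continuous on `J` and
`f (l X + (1 - l) Y) ≤ l f (X) + (1 - l) f (Y)` for all bounded self-adjoint operators `X`, `Y`
with spectra in `J` on any complex Hilbert space and all `l ∈ [0, 1]`. Here `f (X)` is the
continuous functional calculus and `≤` is the Loewner order. The values of `f` outside `J` play
no role. -/
structure OperatorConvexOn (J : Set ℝ) (f : ℝ → ℝ) : Prop where
  ordConnected : J.OrdConnected
  continuousOn : ContinuousOn f J
  le : ∀ (K : Type u) [NormedAddCommGroup K] [InnerProductSpace ℂ K] [CompleteSpace K]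
    (X Y : K →L[ℂ] K), IsSelfAdjoint X → IsSelfAdjoint Y →
    spectrum ℝ X ⊆ J → spectrum ℝ Y ⊆ J → ∀ l : ℝ, 0 ≤ l → l ≤ 1 →
      cfc f (l • X + (1 - l) • Y) ≤ l • cfc f X + (1 - l) • cfc f Y

variable {H : Type u} [NormedAddCommGroup H] [InnerProductSpace ℂ H] [CompleteSpace H]

/-- The transformed operator `R ^ (-1/2) L R ^ (-1/2)`. -/
def transformed (L R : H →L[ℂ] H) : H →L[ℂ] H :=
  R ^ (-(1 / 2) : ℝ) * L * R ^ (-(1 / 2) : ℝ)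

/-- The domain of the perspective function of a function on `J`: the pairs `(L, R)` with `L`
self-adjoint, `R` strictly positive (positive and invertible), and the spectrum of
`R ^ (-1/2) L R ^ (-1/2)` contained in `J`. -/
structure PerspectiveDomain (J : Set ℝ) (L R : H →L[ℂ] H) : Prop where
  isSelfAdjoint : IsSelfAdjoint L
  isStrictlyPositive : IsStrictlyPositive R
  spectrum_subset : spectrum ℝ (transformed L R) ⊆ J

/-- The (non-commutative) perspective function of `f`,
`g (L, R) = R ^ (1/2) f (R ^ (-1/2) L R ^ (-1/2)) R ^ (1/2)`. -/
def perspective (f : ℝ → ℝ) (L R : H →L[ℂ] H) : H →L[ℂ] H :=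
  R ^ (1 / 2 : ℝ) * cfc f (transformed L R) * R ^ (1 / 2 : ℝ)

/-- The convention `0 f (0 / 0) = 0` is built into the definition of `perspective`. -/
theorem perspective_zero (f : ℝ → ℝ) : perspective f (0 : H →L[ℂ] H) 0 = 0 := by
  have h : (0 : H →L[ℂ] H) ^ (1 / 2 : ℝ) = 0 := by
    rw [CFC.rpow_def, cfc_apply_zero]
    simp
  simp only [perspective, h, zero_mul]

/-- The non-commutative `f`-divergence functional of two fields of operators,
`Θ (A, B) = ∫ B_t ^ (1/2) f (B_t ^ (-1/2) A_t B_t ^ (-1/2)) B_t ^ (1/2) dμ(t)`. -/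
def divergence {T : Type v} [MeasurableSpace T] (f : ℝ → ℝ) (μ : Measure T)
    (A B : T → H →L[ℂ] H) : H →L[ℂ] H :=
  ∫ t, perspective f (A t) (B t) ∂μ

end

/-! The perspective is positively homogeneous (`perspective_smul`) and subadditive
(`OperatorConvexOn.perspective_add_le`). Homogeneity turns the left side into `g(A, B)`, and
splitting the integrals over `T₁` and `T₂` makes the first inequality subadditivity.

Subadditivity comes from the operator Jensen inequality with weights `C_i = R_i^(1/2) (R₁ +
R₂)^(-1/2)`. That inequality is the compression inequality for an isometry, applied to a direct sum;
the compression inequality follows from convexity by averaging with a reflection.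

The second inequality is Jensen's inequality on each piece: the mean of a field lies in the closure
of the convex epigraph of `g`, and `g` is continuous on its domain. Since `J` may be neither open
nor closed, membership of the integrals in the domain needs its own argument:
`perspectiveDomain_iff` rewrites it as strict positivity of operators linear in `(L, R)`, which
survives integration over a non-null set. -/

open ContinuousLinearMap in
theorem ContinuousLinearMap.adjoint_conj_mono {H K : Type*} [NormedAddCommGroup H]
    [InnerProductSpace ℂ H] [CompleteSpace H] [NormedAddCommGroup K] [InnerProductSpace ℂ K]
    [CompleteSpace K] {X Y : K →L[ℂ] K} (h : X ≤ Y) (V : H →L[ℂ] K) :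
    adjoint V ∘L X ∘L V ≤ adjoint V ∘L Y ∘L V := by
  rw [ContinuousLinearMap.le_def] at h ⊢
  have := h.adjoint_conj V
  simpa [comp_sub, sub_comp] using this

/-! ### The domain of the perspective: cone structure and integrals. -/

section Domain

variable {H : Type u} [NormedAddCommGroup H] [InnerProductSpace ℂ H] [CompleteSpace H]

theorem IsStrictlyPositive.exists_pos_smul_one_le {X : H →L[ℂ] H} (h : IsStrictlyPositive X) :
    ∃ c : ℝ, 0 < c ∧ c • (1 : H →L[ℂ] H) ≤ X := by
  rcases subsingleton_or_nontrivial (H →L[ℂ] H) with _ | _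
  · exact ⟨1, one_pos, (Subsingleton.elim _ _).le⟩
  obtain ⟨c, hc, h⟩ := (CFC.exists_pos_algebraMap_le_iff h.isSelfAdjoint).2
    fun x hx ↦ h.spectrum_pos hx
  exact ⟨c, hc, by rwa [← Algebra.algebraMap_eq_smul_one]⟩

theorem isStrictlyPositive_of_smul_one_le {X : H →L[ℂ] H} {c : ℝ} (hc : 0 < c)
    (h : c • (1 : H →L[ℂ] H) ≤ X) : IsStrictlyPositive X :=
  (IsStrictlyPositive.smul hc isStrictlyPositive_one).of_le h

open ContinuousLinearMap in
theorem IsStrictlyPositive.adjoint_conj {K : Type*} [NormedAddCommGroup K] [InnerProductSpace ℂ K]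
    [CompleteSpace K] {X : K →L[ℂ] K} (h : IsStrictlyPositive X) {V : H →L[ℂ] K}
    (hV : adjoint V ∘L V = 1) : IsStrictlyPositive (adjoint V ∘L X ∘L V) := by
  obtain ⟨c, hc, hX⟩ := h.exists_pos_smul_one_le
  refine isStrictlyPositive_of_smul_one_le hc ?_
  have := adjoint_conj_mono hX V
  rwa [smul_comp, comp_smul, ContinuousLinearMap.one_def, id_comp, hV] at this

theorem isSelfAdjoint_transformed {L R : H →L[ℂ] H} (hL : IsSelfAdjoint L) :
    IsSelfAdjoint (transformed L R) := by
  have h : IsSelfAdjoint (R ^ (-(1 / 2) : ℝ)) := .of_nonneg CFC.rpow_nonneg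
  have := hL.conjugate (R ^ (-(1 / 2) : ℝ))
  rwa [h.star_eq] at this

theorem transformed_sub_smul {L R : H →L[ℂ] H} (hR : IsStrictlyPositive R) (r : ℝ) :
    R ^ (-(1 / 2) : ℝ) * (L - r • R) * R ^ (-(1 / 2) : ℝ) =
      transformed L R - algebraMap ℝ (H →L[ℂ] H) r := by
  rw [mul_sub, sub_mul, mul_smul_comm, smul_mul_assoc, CFC.conjugate_rpow_neg_one_half R,
    Algebra.algebraMap_eq_smul_one, transformed]

theorem mem_spectrum_sub_algebraMap_iff {𝕜 A : Type*} [CommRing 𝕜] [Ring A] [Algebra 𝕜 A] {a : A}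
    {r x : 𝕜} : x ∈ spectrum 𝕜 (a - algebraMap 𝕜 A r) ↔ x + r ∈ spectrum 𝕜 a := by
  rw [spectrum.mem_iff, spectrum.mem_iff, map_add, sub_sub_eq_add_sub]

/-- Congruence by the invertible `R^(-1/2)` preserves strict positivity and turns `L - r • R` into
`transformed L R - r`. -/
theorem isStrictlyPositive_sub_smul_iff {L R : H →L[ℂ] H} (hL : IsSelfAdjoint L)
    (hR : IsStrictlyPositive R) (r : ℝ) :
    IsStrictlyPositive (L - r • R) ↔ ∀ x ∈ spectrum ℝ (transformed L R), r < x := by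
  have hD : IsSelfAdjoint (R ^ (-(1 / 2) : ℝ)) := .of_nonneg CFC.rpow_nonneg
  have hX := isSelfAdjoint_transformed (R := R) hL
  rw [← (hR.isUnit.cfcRpow (-(1 / 2))).isStrictlyPositive_iff_conjugate_of_isSelfAdjoint _ _ hD,
    transformed_sub_smul hR, StarOrderedRing.isStrictlyPositive_iff_spectrum_pos (R := ℝ) _
      (hX.sub (.algebraMap _ (.all r)))]
  refine ⟨fun h x hx ↦ ?_, fun h x hx ↦ ?_⟩
  · have := h (x - r) (by rwa [mem_spectrum_sub_algebraMap_iff, sub_add_cancel])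
    linarith
  · have := h (x + r) (mem_spectrum_sub_algebraMap_iff.1 hx)
    linarith

theorem isStrictlyPositive_smul_sub_iff {L R : H →L[ℂ] H} (hL : IsSelfAdjoint L)
    (hR : IsStrictlyPositive R) (r : ℝ) :
    IsStrictlyPositive (r • R - L) ↔ ∀ x ∈ spectrum ℝ (transformed L R), x < r := by
  have := isStrictlyPositive_sub_smul_iff hL.neg hR (-r)
  have h : transformed (-L) R = - transformed L R := by simp [transformed]
  rw [h, ← spectrum.neg_eq, neg_smul, sub_neg_eq_add, neg_add_eq_sub] at this
  rw [this]
  refine ⟨fun h x hx ↦ ?_, fun h x hx ↦ ?_⟩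
  · have := h (-x) (by simpa using hx)
    linarith
  · have := h (-x) (by simpa using hx)
    linarith

/-- A point outside an interval is a strict lower or a strict upper bound of it, so the spectral
condition becomes a family of conditions linear in `(L, R)`, stable under sums, positive scaling and
integrals. -/
theorem perspectiveDomain_iff {J : Set ℝ} (hJ : J.OrdConnected) {L R : H →L[ℂ] H} :
    PerspectiveDomain J L R ↔ IsSelfAdjoint L ∧ IsStrictlyPositive R ∧
      (∀ r : ℝ, (∀ x ∈ J, r < x) → IsStrictlyPositive (L - r • R)) ∧
      ∀ r : ℝ, (∀ x ∈ J, x < r) → IsStrictlyPositive (r • R - L) := by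
  refine ⟨fun h ↦ ⟨h.1, h.2, fun r hr ↦ ?_, fun r hr ↦ ?_⟩, fun ⟨hL, hR, h₁, h₂⟩ ↦ ⟨hL, hR, ?_⟩⟩
  · exact (isStrictlyPositive_sub_smul_iff h.1 h.2 r).2 fun x hx ↦ hr x (h.3 hx)
  · exact (isStrictlyPositive_smul_sub_iff h.1 h.2 r).2 fun x hx ↦ hr x (h.3 hx)
  · intro r hr
    by_contra hrJ
    have : (∀ x ∈ J, r < x) ∨ ∀ x ∈ J, x < r := by
      by_contra! hcon
      obtain ⟨⟨x, hx, hxr⟩, y, hy, hry⟩ := hcon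
      exact hrJ (hJ.out hx hy ⟨hxr, hry⟩)
    rcases this with h | h
    · exact lt_irrefl r ((isStrictlyPositive_sub_smul_iff hL hR r).1 (h₁ r h) r hr)
    · exact lt_irrefl r ((isStrictlyPositive_smul_sub_iff hL hR r).1 (h₂ r h) r hr)

theorem PerspectiveDomain.add {J : Set ℝ} (hJ : J.OrdConnected) {L₁ R₁ L₂ R₂ : H →L[ℂ] H}
    (h₁ : PerspectiveDomain J L₁ R₁) (h₂ : PerspectiveDomain J L₂ R₂) :
    PerspectiveDomain J (L₁ + L₂) (R₁ + R₂) := by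
  rw [perspectiveDomain_iff hJ] at *
  refine ⟨h₁.1.add h₂.1, h₁.2.1.add_nonneg h₂.2.1.nonneg, fun r hr ↦ ?_, fun r hr ↦ ?_⟩
  · rw [smul_add, add_sub_add_comm]
    exact (h₁.2.2.1 r hr).add_nonneg (h₂.2.2.1 r hr).nonneg
  · rw [smul_add, add_sub_add_comm]
    exact (h₁.2.2.2 r hr).add_nonneg (h₂.2.2.2 r hr).nonneg

theorem PerspectiveDomain.smul {J : Set ℝ} (hJ : J.OrdConnected) {L R : H →L[ℂ] H}
    (h : PerspectiveDomain J L R) {c : ℝ} (hc : 0 < c) : PerspectiveDomain J (c • L) (c • R) := by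
  rw [perspectiveDomain_iff hJ] at *
  refine ⟨(IsSelfAdjoint.all c).smul h.1, h.2.1.smul hc, fun r hr ↦ ?_, fun r hr ↦ ?_⟩
  · rw [smul_comm r c, ← smul_sub]
    exact (h.2.2.1 r hr).smul hc
  · rw [smul_comm r c, ← smul_sub]
    exact (h.2.2.2 r hr).smul hc

theorem transformed_one (X : H →L[ℂ] H) : transformed X 1 = X := by
  simp [transformed]

/-- Lets the cone properties of the domain control spectra of convex combinations and compressions.
-/
theorem perspectiveDomain_one_iff {J : Set ℝ} {X : H →L[ℂ] H} :
    PerspectiveDomain J X 1 ↔ IsSelfAdjoint X ∧ spectrum ℝ X ⊆ J :=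
  ⟨fun h ↦ ⟨h.1, transformed_one X ▸ h.3⟩,
    fun h ↦ ⟨h.1, isStrictlyPositive_one, (transformed_one X).symm ▸ h.2⟩⟩

open ContinuousLinearMap in
theorem PerspectiveDomain.adjoint_conj {J : Set ℝ} (hJ : J.OrdConnected)
    {K : Type*} [NormedAddCommGroup K] [InnerProductSpace ℂ K]
    [CompleteSpace K] {X : K →L[ℂ] K} (h : PerspectiveDomain J X 1) {V : H →L[ℂ] K}
    (hV : adjoint V ∘L V = 1) : PerspectiveDomain J (adjoint V ∘L X ∘L V) 1 := by
  rw [perspectiveDomain_iff hJ] at *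
  refine ⟨h.1.adjoint_conj V, isStrictlyPositive_one, fun r hr ↦ ?_, fun r hr ↦ ?_⟩
  · convert (h.2.2.1 r hr).adjoint_conj hV using 1
    rw [sub_comp, comp_sub, smul_comp, comp_smul,
      show (1 : K →L[ℂ] K) ∘L V = V from id_comp V, hV]
  · convert (h.2.2.2 r hr).adjoint_conj hV using 1
    rw [sub_comp, comp_sub, smul_comp, comp_smul,
      show (1 : K →L[ℂ] K) ∘L V = V from id_comp V, hV]

/-- The lower bound of `X t` depends on `t`, but the sets where `1 / (n + 1)` is a bound exhaust
`S`; one of them is non-null and alone bounds the integral below. -/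
theorem isStrictlyPositive_setIntegral {T : Type v} [TopologicalSpace T] [MeasurableSpace T]
    [BorelSpace T] {μ : Measure T} [IsFiniteMeasure μ] {S : Set T} (hS : MeasurableSet S)
    (hμ : μ S ≠ 0) {X : T → H →L[ℂ] H} (hc : Continuous X) (hi : Integrable X μ)
    (hX : ∀ t, IsStrictlyPositive (X t)) : IsStrictlyPositive (∫ t in S, X t ∂μ) := by
  let E (n : ℕ) : Set T := S ∩ {t | (1 / ((n : ℝ) + 1)) • (1 : H →L[ℂ] H) ≤ X t}
  have hE (n) : MeasurableSet (E n) :=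
    hS.inter (isClosed_le continuous_const hc).measurableSet
  have hU : ⋃ n, E n = S := by
    refine Set.Subset.antisymm (Set.iUnion_subset fun n ↦ Set.inter_subset_left) fun t ht ↦ ?_
    obtain ⟨c, hc0, hct⟩ := (hX t).exists_pos_smul_one_le
    obtain ⟨n, hn⟩ := exists_nat_one_div_lt hc0
    exact Set.mem_iUnion.2 ⟨n, ht, (smul_le_smul_of_nonneg_right hn.le zero_le_one).trans hct⟩
  obtain ⟨n, hn⟩ : ∃ n, μ (E n) ≠ 0 := by
    by_contra! h
    exact hμ (hU ▸ measure_iUnion_null h)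
  refine isStrictlyPositive_of_smul_one_le (c := μ.real (E n) * (1 / ((n : ℝ) + 1))) ?_ ?_
  · have : 0 < μ.real (E n) := ENNReal.toReal_pos hn (measure_ne_top _ _)
    positivity
  · calc (μ.real (E n) * (1 / ((n : ℝ) + 1))) • (1 : H →L[ℂ] H)
        = ∫ t in E n, (1 / ((n : ℝ) + 1)) • (1 : H →L[ℂ] H) ∂μ := by
          rw [setIntegral_const, mul_smul]
      _ ≤ ∫ t in E n, X t ∂μ :=
          setIntegral_mono_on (integrable_const _).integrableOn hi.integrableOn (hE n)
            fun t ht ↦ ht.2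
      _ ≤ ∫ t in S, X t ∂μ :=
          setIntegral_mono_set hi.integrableOn (ae_of_all _ fun t ↦ (hX t).nonneg)
            (ae_of_all _ fun t ht ↦ ht.1)

theorem PerspectiveDomain.setIntegral {J : Set ℝ} (hJ : J.OrdConnected) {T : Type v}
    [TopologicalSpace T] [MeasurableSpace T] [BorelSpace T] {μ : Measure T} [IsFiniteMeasure μ]
    {S : Set T} (hS : MeasurableSet S) (hμ : μ S ≠ 0) {A B : T → H →L[ℂ] H} (hAc : Continuous A)
    (hBc : Continuous B) (hA : Integrable A μ) (hB : Integrable B μ)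
    (h : ∀ t, PerspectiveDomain J (A t) (B t)) :
    PerspectiveDomain J (∫ t in S, A t ∂μ) (∫ t in S, B t ∂μ) := by
  simp only [perspectiveDomain_iff hJ] at *
  refine ⟨?_, isStrictlyPositive_setIntegral hS hμ hBc hB fun t ↦ (h t).2.1,
    fun r hr ↦ ?_, fun r hr ↦ ?_⟩
  · have := (((starL' ℝ : (H →L[ℂ] H) ≃L[ℝ] (H →L[ℂ] H)) : (H →L[ℂ] H) →L[ℝ] (H →L[ℂ] H))
      ).integral_comp_comm (μ := μ.restrict S) hA.integrableOn
    simp only [ContinuousLinearEquiv.coe_coe, starL'_apply, (h _).1.star_eq] at this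
    exact this.symm
  · rw [← integral_smul, ← integral_sub (g := fun t ↦ r • B t) hA.integrableOn (hB.integrableOn.smul r)]
    exact isStrictlyPositive_setIntegral hS hμ (by fun_prop) (hA.sub (hB.smul r))
      fun t ↦ (h t).2.2.1 r hr
  · rw [← integral_smul, ← integral_sub (f := fun t ↦ r • B t) (hB.integrableOn.smul r) hA.integrableOn]
    exact isStrictlyPositive_setIntegral hS hμ (by fun_prop) ((hB.smul r).sub hA)
      fun t ↦ (h t).2.2.2 r hr

end Domain

theorem IsCompact.exists_subset_Icc_subset {J U : Set ℝ} (hJ : J.OrdConnected) (hU : IsCompact U)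
    (h : U ⊆ J) : ∃ a b : ℝ, U ⊆ Set.Icc a b ∧ Set.Icc a b ⊆ J := by
  rcases U.eq_empty_or_nonempty with rfl | hne
  · exact ⟨1, 0, by simp, by simp⟩
  · exact ⟨sInf U, sSup U, subset_Icc_csInf_csSup hU.bddBelow hU.bddAbove,
      hJ.out (h (hU.sInf_mem hne)) (h (hU.sSup_mem hne))⟩

/-! ### Operator Jensen inequality and subadditivity of the perspective. -/

section Convexity

open ContinuousLinearMap

variable {H K : Type u} [NormedAddCommGroup H] [InnerProductSpace ℂ H] [CompleteSpace H]
  [NormedAddCommGroup K] [InnerProductSpace ℂ K] [CompleteSpace K]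

theorem aeval_comp_eq_comp_aeval {H K : Type*} [NormedAddCommGroup H] [InnerProductSpace ℂ H]
    [NormedAddCommGroup K] [InnerProductSpace ℂ K] {X : K →L[ℂ] K} {Z : H →L[ℂ] H} {W : H →L[ℂ] K}
    (h : X ∘L W = W ∘L Z) (p : Polynomial ℝ) :
    Polynomial.aeval X p ∘L W = W ∘L Polynomial.aeval Z p := by
  induction p using Polynomial.induction_on' with
  | add p q hp hq => simp only [map_add, add_comp, comp_add, hp, hq]
  | monomial n c =>
    simp only [Polynomial.aeval_monomial, ← Algebra.smul_def]
    rw [smul_comp, comp_smul]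
    congr 1
    induction n with
    | zero => rfl
    | succ n ih =>
      calc (X ^ (n + 1) : K →L[ℂ] K) ∘L W = (X ^ n : K →L[ℂ] K) ∘L (X ∘L W) := by rw [pow_succ]; rfl
        _ = ((X ^ n : K →L[ℂ] K) ∘L W) ∘L Z := by rw [h]; rfl
        _ = W ∘L (Z ^ (n + 1) : H →L[ℂ] H) := by rw [ih, pow_succ]; rfl

theorem norm_cfc_sub_aeval_le {X : H →L[ℂ] H} (hX : IsSelfAdjoint X) {f : ℝ → ℝ}
    {p : Polynomial ℝ} {ε : ℝ} (hε : 0 ≤ ε) (hf : ContinuousOn f (spectrum ℝ X))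
    (h : ∀ x ∈ spectrum ℝ X, |p.eval x - f x| ≤ ε) :
    ‖cfc f X - Polynomial.aeval X p‖ ≤ ε := by
  rw [← cfc_polynomial p X hX, ← cfc_sub f p.eval X hf p.continuous.continuousOn]
  exact norm_cfc_le hε fun x hx ↦ by rw [norm_sub_rev]; exact h x hx

/-- An operator which intertwines two self-adjoint operators intertwines their functional
calculi. -/
theorem cfc_comp_eq_comp_cfc {J : Set ℝ} (hJ : J.OrdConnected) {f : ℝ → ℝ}
    (hf : ContinuousOn f J) {X : K →L[ℂ] K} {Z : H →L[ℂ] H} (hX : PerspectiveDomain J X 1)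
    (hZ : PerspectiveDomain J Z 1) {W : H →L[ℂ] K} (h : X ∘L W = W ∘L Z) :
    cfc f X ∘L W = W ∘L cfc f Z := by
  rw [perspectiveDomain_one_iff] at hX hZ
  -- One interval holds both spectra, so a single polynomial approximates `f` for both operators.
  obtain ⟨a, b, hU, hI⟩ := IsCompact.exists_subset_Icc_subset hJ
    ((ContinuousFunctionalCalculus.isCompact_spectrum (R := ℝ) X).union
      (ContinuousFunctionalCalculus.isCompact_spectrum (R := ℝ) Z)) (Set.union_subset hX.2 hZ.2)
  rw [← sub_eq_zero, ← norm_le_zero_iff]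
  refine le_of_forall_pos_le_add fun ε hε ↦ ?_
  obtain ⟨δ, hδ, hδε⟩ : ∃ δ > 0, 2 * ‖W‖ * δ ≤ ε := by
    refine ⟨ε / (2 * ‖W‖ + 1), by positivity, ?_⟩
    rw [mul_div_assoc', div_le_iff₀ (by positivity)]
    nlinarith [norm_nonneg W]
  obtain ⟨p, hp⟩ := exists_polynomial_near_of_continuousOn a b f (hf.mono hI) δ hδ
  have h₁ := norm_cfc_sub_aeval_le hX.1 hδ.le (hf.mono hX.2)
    fun x hx ↦ (hp x (hU (.inl hx))).le
  have h₂ := norm_cfc_sub_aeval_le hZ.1 hδ.le (hf.mono hZ.2)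
    fun x hx ↦ (hp x (hU (.inr hx))).le
  have key : cfc f X ∘L W - W ∘L cfc f Z = (cfc f X - Polynomial.aeval X p) ∘L W -
      W ∘L (cfc f Z - Polynomial.aeval Z p) := by
    rw [sub_comp, comp_sub, aeval_comp_eq_comp_aeval h]
    abel
  calc ‖cfc f X ∘L W - W ∘L cfc f Z‖
      ≤ ‖cfc f X - Polynomial.aeval X p‖ * ‖W‖ + ‖W‖ * ‖cfc f Z - Polynomial.aeval Z p‖ := by
        rw [key]
        exact (norm_sub_le _ _).trans (add_le_add (opNorm_comp_le _ _) (opNorm_comp_le _ _))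
    _ ≤ δ * ‖W‖ + ‖W‖ * δ := by gcongr
    _ ≤ 0 + ε := by linarith

/-- The Hansen-Pedersen-Davis inequality for compression by an isometry. -/
theorem OperatorConvexOn.cfc_adjoint_conj_le {J : Set ℝ} {f : ℝ → ℝ}
    (hf : OperatorConvexOn.{u} J f) {X : K →L[ℂ] K} (hX : PerspectiveDomain J X 1)
    {V : H →L[ℂ] K} (hV : adjoint V ∘L V = 1) :
    cfc f (adjoint V ∘L X ∘L V) ≤ adjoint V ∘L cfc f X ∘L V := by
  have hJ := hf.ordConnected
  have hV' (x : H) : adjoint V (V x) = x := congr($hV x)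
  -- The reflection fixing the range of `V`: averaging `X` with `S X S` removes the off-diagonal
  -- blocks.
  let S : K →L[ℂ] K := (2 : ℂ) • (V ∘L adjoint V) - 1
  have hS (x : K) : S x = (2 : ℂ) • V (adjoint V x) - x := rfl
  have hSa : adjoint S = S := by
    rw [map_sub, map_smulₛₗ, adjoint_comp, adjoint_adjoint, ContinuousLinearMap.one_def,
      adjoint_id]
    simp [S, ContinuousLinearMap.one_def, map_ofNat]
  have hSV (x : H) : S (V x) = V x := by rw [hS, hV', two_smul, add_sub_cancel_right]
  have hVS (x : K) : adjoint V (S x) = adjoint V x := by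
    rw [hS, map_sub, map_smul, hV', two_smul, add_sub_cancel_right]
  have hSS (x : K) : S (S x) = x := by rw [hS (S x), hVS, hS, sub_sub_cancel]
  have hSS' : adjoint S ∘L S = 1 := by
    rw [hSa]
    ext x
    exact hSS x
  have hM := hX.adjoint_conj hJ hSS'
  have hZ := hX.adjoint_conj hJ hV
  rw [hSa] at hM
  set M := S ∘L X ∘L S with hMdef
  have hfM : cfc f M = S ∘L cfc f X ∘L S := by
    have := cfc_comp_eq_comp_cfc hJ hf.continuousOn hX hM (W := S)
      (by ext x; simp [hMdef, hSS])
    rw [this]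
    ext x
    simp [hSS]
  have hY : PerspectiveDomain J ((1 / 2 : ℝ) • X + (1 - 1 / 2 : ℝ) • M) 1 := by
    have := (hX.smul hJ (c := 1 / 2) (by norm_num)).add hJ
      (hM.smul hJ (c := 1 - 1 / 2) (by norm_num))
    rwa [← add_smul, add_sub_cancel, one_smul] at this
  -- On the range of `V` the average acts as the compression `V* X V`.
  have hfY := cfc_comp_eq_comp_cfc hJ hf.continuousOn hY hZ (W := V) (by
    ext x
    simp only [hMdef, comp_apply, add_apply, smul_apply, hSV]
    rw [hS]
    module)
  have hle := adjoint_conj_mono (hf.le K X M hX.1 hM.1 (perspectiveDomain_one_iff.1 hX).2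
    (perspectiveDomain_one_iff.1 hM).2 (1 / 2) (by norm_num) (by norm_num)) V
  rw [hfY, hfM] at hle
  convert hle using 1
  · ext x
    simp [hV']
  · ext x
    simp only [comp_apply, add_apply, smul_apply, hSV, map_add, map_smul_of_tower, hVS]
    module

/-- The operator Jensen inequality for two operators. -/
theorem OperatorConvexOn.cfc_adjoint_conj_add_le {J : Set ℝ} {f : ℝ → ℝ}
    (hf : OperatorConvexOn.{u} J f) {X₁ X₂ : H →L[ℂ] H} (hX₁ : PerspectiveDomain J X₁ 1)
    (hX₂ : PerspectiveDomain J X₂ 1) {C₁ C₂ : H →L[ℂ] H}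
    (hC : adjoint C₁ ∘L C₁ + adjoint C₂ ∘L C₂ = 1) :
    cfc f (adjoint C₁ ∘L X₁ ∘L C₁ + adjoint C₂ ∘L X₂ ∘L C₂) ≤
      adjoint C₁ ∘L cfc f X₁ ∘L C₁ + adjoint C₂ ∘L cfc f X₂ ∘L C₂ := by
  have hJ := hf.ordConnected
  let i₁ : H →L[ℂ] WithLp 2 (H × H) :=
    (WithLp.prodContinuousLinearEquiv 2 ℂ H H).symm.toContinuousLinearMap ∘L inl ℂ H H
  let i₂ : H →L[ℂ] WithLp 2 (H × H) :=
    (WithLp.prodContinuousLinearEquiv 2 ℂ H H).symm.toContinuousLinearMap ∘L inr ℂ H H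
  have hi₁ (x : H) : i₁ x = WithLp.toLp 2 (x, 0) := rfl
  have hi₂ (x : H) : i₂ x = WithLp.toLp 2 (0, x) := rfl
  have hp₁ (y : WithLp 2 (H × H)) : adjoint i₁ y = y.fst := by
    refine ext_inner_left ℂ fun x ↦ ?_
    simp [adjoint_inner_right, hi₁, WithLp.prod_inner_apply]
  have hp₂ (y : WithLp 2 (H × H)) : adjoint i₂ y = y.snd := by
    refine ext_inner_left ℂ fun x ↦ ?_
    simp [adjoint_inner_right, hi₂, WithLp.prod_inner_apply]
  have h₁₁ (x : H) : adjoint i₁ (i₁ x) = x := by simp [hp₁, hi₁]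
  have h₂₂ (x : H) : adjoint i₂ (i₂ x) = x := by simp [hp₂, hi₂]
  have h₁₂ (x : H) : adjoint i₁ (i₂ x) = 0 := by simp [hp₁, hi₂]
  have h₂₁ (x : H) : adjoint i₂ (i₁ x) = 0 := by simp [hp₂, hi₁]
  have hsum (y : WithLp 2 (H × H)) : i₁ (adjoint i₁ y) + i₂ (adjoint i₂ y) = y := by
    rw [hp₁, hp₂, hi₁, hi₂, ← WithLp.toLp_add]
    simp only [Prod.mk_add_mk, add_zero, zero_add]
    rfl
  clear_value i₁ i₂
  let X := i₁ ∘L X₁ ∘L adjoint i₁ + i₂ ∘L X₂ ∘L adjoint i₂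
  have hXi₁ : X ∘L i₁ = i₁ ∘L X₁ := by ext x; simp [X, h₁₁, h₂₁]
  have hXi₂ : X ∘L i₂ = i₂ ∘L X₂ := by ext x; simp [X, h₂₂, h₁₂]
  have hX : PerspectiveDomain J X 1 := by
    rw [perspectiveDomain_one_iff] at *
    refine ⟨.add ?_ ?_, fun r hr ↦ ?_⟩
    · simpa using hX₁.1.adjoint_conj (adjoint i₁)
    · simpa using hX₂.1.adjoint_conj (adjoint i₂)
    by_contra hrJ
    -- Outside `J` both blocks of `r - X` are invertible, and the direct sum of their inverses
    -- inverts `r - X`.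
    obtain ⟨u, hu₁, hu₂⟩ := isUnit_iff_exists.1 (spectrum.notMem_iff.1 fun h ↦ hrJ (hX₁.2 h))
    obtain ⟨v, hv₁, hv₂⟩ := isUnit_iff_exists.1 (spectrum.notMem_iff.1 fun h ↦ hrJ (hX₂.2 h))
    have e (y : WithLp 2 (H × H)) : (algebraMap ℝ _ r - X) y =
        i₁ ((algebraMap ℝ (H →L[ℂ] H) r - X₁) (adjoint i₁ y)) +
          i₂ ((algebraMap ℝ (H →L[ℂ] H) r - X₂) (adjoint i₂ y)) := by
      simp only [Algebra.algebraMap_eq_smul_one, sub_apply, smul_apply, ContinuousLinearMap.one_def,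
        id_apply, add_apply, comp_apply, map_sub, map_smul_of_tower, X]
      conv_lhs => enter [1, 2]; rw [← hsum y]
      rw [smul_add]
      abel
    refine spectrum.mem_iff.1 hr (isUnit_iff_exists.2
      ⟨i₁ ∘L u ∘L adjoint i₁ + i₂ ∘L v ∘L adjoint i₂, ?_, ?_⟩)
    · ext y
      have a₁ : (algebraMap ℝ _ r - X₁) (u (adjoint i₁ y)) = adjoint i₁ y := congr($hu₁ _)
      have a₂ : (algebraMap ℝ _ r - X₂) (v (adjoint i₂ y)) = adjoint i₂ y := congr($hv₁ _)
      change (algebraMap ℝ _ r - X) (i₁ (u (adjoint i₁ y)) + i₂ (v (adjoint i₂ y))) = y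
      rw [e]
      simp only [map_add, h₁₁, h₂₂, h₁₂, h₂₁, add_zero, zero_add, a₁, a₂, hsum]
    · ext y
      have a₁ : u ((algebraMap ℝ _ r - X₁) (adjoint i₁ y)) = adjoint i₁ y := congr($hu₂ _)
      have a₂ : v ((algebraMap ℝ _ r - X₂) (adjoint i₂ y)) = adjoint i₂ y := congr($hv₂ _)
      change i₁ (u (adjoint i₁ ((algebraMap ℝ _ r - X) y))) +
        i₂ (v (adjoint i₂ ((algebraMap ℝ _ r - X) y))) = y
      rw [e]
      simp only [map_add, h₁₁, h₂₂, h₁₂, h₂₁, add_zero, zero_add, a₁, a₂, hsum]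
  have hf₁ := cfc_comp_eq_comp_cfc hJ hf.continuousOn hX hX₁ hXi₁
  have hf₂ := cfc_comp_eq_comp_cfc hJ hf.continuousOn hX hX₂ hXi₂
  have hf₁' (x : H) : cfc f X (i₁ x) = i₁ (cfc f X₁ x) := congr($hf₁ x)
  have hf₂' (x : H) : cfc f X (i₂ x) = i₂ (cfc f X₂ x) := congr($hf₂ x)
  -- The column `(C₁, C₂)` is an isometry by `hC`; compressing `X` by it gives the weighted sum.
  have hadj : adjoint (i₁ ∘L C₁ + i₂ ∘L C₂) =
      adjoint C₁ ∘L adjoint i₁ + adjoint C₂ ∘L adjoint i₂ := by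
    rw [map_add, adjoint_comp, adjoint_comp]
  have hV : adjoint (i₁ ∘L C₁ + i₂ ∘L C₂) ∘L (i₁ ∘L C₁ + i₂ ∘L C₂) = 1 := by
    rw [hadj, ← hC]
    ext x
    simp [h₁₁, h₂₂, h₁₂, h₂₁]
  have := hf.cfc_adjoint_conj_le hX hV
  rw [hadj] at this
  convert this using 1
  · congr 1
    ext x
    simp [X, h₁₁, h₂₂, h₁₂, h₂₁]
  · ext x
    simp [hf₁', hf₂', h₁₁, h₂₂, h₁₂, h₂₁]

theorem CFC.smul_rpow {c : ℝ} (hc : 0 < c) {R : H →L[ℂ] H} (hR : IsStrictlyPositive R) (s : ℝ) :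
    (c • R) ^ s = c ^ s • R ^ s := by
  have hpos : ∀ x ∈ spectrum ℝ R, 0 < x := fun x hx ↦ hR.spectrum_pos hx
  have hcont : ContinuousOn (fun x : ℝ ↦ x ^ s) (spectrum ℝ R) :=
    continuousOn_id.rpow_const fun x hx ↦ .inl (hpos x hx).ne'
  have h := CFC.cfc_rpow (a := R) (y := s) (f := fun x ↦ c * x)
    (fun x hx ↦ mul_pos hc (hpos x hx)) (by fun_prop) hR.isSelfAdjoint
  rw [cfc_const_mul_id c R hR.isSelfAdjoint] at h
  rw [h, CFC.rpow_eq_cfc_real hR.nonneg, ← cfc_smul (c ^ s) (fun x : ℝ ↦ x ^ s) R hcont]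
  exact cfc_congr fun x hx ↦ Real.mul_rpow hc.le (hpos x hx).le

theorem perspective_smul (f : ℝ → ℝ) {L R : H →L[ℂ] H} (hR : IsStrictlyPositive R) {c : ℝ}
    (hc : 0 < c) : perspective f (c • L) (c • R) = c • perspective f L R := by
  have h : transformed (c • L) (c • R) = transformed L R := by
    simp only [transformed, CFC.smul_rpow hc hR, smul_mul_assoc, mul_smul_comm, smul_smul]
    rw [mul_left_comm, ← Real.rpow_add hc]
    norm_num [Real.rpow_neg_one, hc.ne']
  simp only [perspective, h, CFC.smul_rpow hc hR, smul_mul_assoc, mul_smul_comm, smul_smul]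
  rw [← Real.rpow_add hc]
  norm_num

/-- The perspective of an operator convex function is subadditive. -/
theorem OperatorConvexOn.perspective_add_le {J : Set ℝ} {f : ℝ → ℝ}
    (hf : OperatorConvexOn.{u} J f) {L₁ R₁ L₂ R₂ : H →L[ℂ] H}
    (h₁ : PerspectiveDomain J L₁ R₁) (h₂ : PerspectiveDomain J L₂ R₂) :
    perspective f (L₁ + L₂) (R₁ + R₂) ≤ perspective f L₁ R₁ + perspective f L₂ R₂ := by
  have hR := (h₁.add hf.ordConnected h₂).isStrictlyPositive
  set R := R₁ + R₂ with hRdef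
  set D := R ^ (-(1 / 2) : ℝ) with hD
  set G := R ^ (1 / 2 : ℝ) with hG
  have hsa (P : H →L[ℂ] H) (s : ℝ) : adjoint (P ^ s) = P ^ s :=
    (IsSelfAdjoint.of_nonneg CFC.rpow_nonneg).adjoint_eq
  have hadj (P : H →L[ℂ] H) : adjoint (P ^ (1 / 2 : ℝ) * D) = D * P ^ (1 / 2 : ℝ) := by
    rw [hD, ContinuousLinearMap.mul_def, adjoint_comp, hsa, hsa, ContinuousLinearMap.mul_def]
  have hsq {P : H →L[ℂ] H} (hP : IsStrictlyPositive P) : P ^ (1 / 2 : ℝ) * P ^ (1 / 2 : ℝ) = P := by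
    rw [← CFC.rpow_add hP.isUnit]
    norm_num [CFC.rpow_one P hP.nonneg]
  have hC : adjoint (R₁ ^ (1 / 2 : ℝ) * D) ∘L (R₁ ^ (1 / 2 : ℝ) * D) +
      adjoint (R₂ ^ (1 / 2 : ℝ) * D) ∘L (R₂ ^ (1 / 2 : ℝ) * D) = 1 := by
    rw [hadj, hadj, ← ContinuousLinearMap.mul_def, ← ContinuousLinearMap.mul_def]
    calc _ = D * (R₁ ^ (1 / 2 : ℝ) * R₁ ^ (1 / 2 : ℝ)) * D +
          D * (R₂ ^ (1 / 2 : ℝ) * R₂ ^ (1 / 2 : ℝ)) * D := by simp only [mul_assoc]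
      _ = 1 := by
        rw [hsq h₁.2, hsq h₂.2, ← add_mul, ← mul_add, ← hRdef, hD,
          CFC.conjugate_rpow_neg_one_half R]
  have hconj {P L : H →L[ℂ] H} (hP : IsStrictlyPositive P) :
      adjoint (P ^ (1 / 2 : ℝ) * D) ∘L transformed L P ∘L (P ^ (1 / 2 : ℝ) * D) = D * L * D := by
    rw [hadj, ← ContinuousLinearMap.mul_def, ← ContinuousLinearMap.mul_def, transformed]
    calc _ = D * (P ^ (1 / 2 : ℝ) * P ^ (-(1 / 2) : ℝ)) * L *
          (P ^ (-(1 / 2) : ℝ) * P ^ (1 / 2 : ℝ)) * D := by simp only [mul_assoc]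
      _ = D * L * D := by
        rw [CFC.rpow_mul_rpow_neg _ hP, CFC.rpow_neg_mul_rpow _ hP, mul_one, mul_one]
  have key := hf.cfc_adjoint_conj_add_le
    (perspectiveDomain_one_iff.2 ⟨isSelfAdjoint_transformed h₁.1, h₁.3⟩)
    (perspectiveDomain_one_iff.2 ⟨isSelfAdjoint_transformed h₂.1, h₂.3⟩) hC
  rw [hconj h₁.2, hconj h₂.2, ← add_mul, ← mul_add] at key
  have hGD : G * D = 1 := CFC.rpow_mul_rpow_neg _ hR
  have hDG : D * G = 1 := CFC.rpow_neg_mul_rpow _ hR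
  -- Conjugating by `R^(1/2)` cancels the factors `R^(-1/2)` in the weights.
  have := adjoint_conj_mono key G
  rw [hsa, ← ContinuousLinearMap.mul_def, ← ContinuousLinearMap.mul_def] at this
  have hterm (P Y : H →L[ℂ] H) : G * ((adjoint (P ^ (1 / 2 : ℝ) * D) ∘L Y ∘L
      (P ^ (1 / 2 : ℝ) * D)) * G) = P ^ (1 / 2 : ℝ) * Y * P ^ (1 / 2 : ℝ) := by
    rw [hadj, ← ContinuousLinearMap.mul_def, ← ContinuousLinearMap.mul_def]
    calc _ = (G * D) * (P ^ (1 / 2 : ℝ) * Y * P ^ (1 / 2 : ℝ)) * (D * G) := by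
          simp only [mul_assoc]
      _ = _ := by rw [hGD, hDG, one_mul, mul_one]
  calc perspective f (L₁ + L₂) R = G * (cfc f (D * (L₁ + L₂) * D) * G) := mul_assoc _ _ _
    _ ≤ _ := this
    _ = perspective f L₁ R₁ + perspective f L₂ R₂ := by
      rw [← ContinuousLinearMap.mul_def, ← ContinuousLinearMap.mul_def, add_mul, mul_add, hterm,
        hterm, perspective, perspective]

end Convexity

/-! ### Measurability of the pieces, and compact neighbourhoods relative to `J`. -/

-- If `U` is open and `U ∩ s` lies in a compact `K ⊆ s`, then `U ∩ closure s ⊆ closure (U ∩ s) ⊆ K ⊆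
-- s`; such `U` cover `s`.
open Topology in
theorem isLocallyClosed_of_locallyCompactSpace {T : Type*} [TopologicalSpace T] [T2Space T]
    {s : Set T} [LocallyCompactSpace s] : IsLocallyClosed s := by
  refine ⟨⋃₀ {U | IsOpen U ∧ ∃ K, IsCompact K ∧ K ⊆ s ∧ U ∩ s ⊆ K}, closure s,
    isOpen_sUnion fun U hU ↦ hU.1, isClosed_closure, Set.Subset.antisymm (fun x hx ↦ ?_) ?_⟩
  · refine ⟨?_, subset_closure hx⟩
    obtain ⟨K, hK, hxK⟩ := exists_compact_mem_nhds (⟨x, hx⟩ : s)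
    obtain ⟨U, hU, hUo, hxU⟩ := mem_nhdsWithin.1 (mem_nhds_subtype_iff_nhdsWithin.1 hxK)
    exact ⟨U, ⟨hU, _, hK.image continuous_subtype_val, by simp, hxU⟩, hUo⟩
  · rintro x ⟨⟨U, ⟨hU, K, hK, hKs, hUK⟩, hxU⟩, hx⟩
    exact hKs (closure_minimal hUK hK.isClosed (hU.inter_closure ⟨hxU, hx⟩))

theorem measurableSet_of_locallyCompactSpace {T : Type*} [TopologicalSpace T] [T2Space T]
    [MeasurableSpace T] [BorelSpace T] (s : Set T) [LocallyCompactSpace s] : MeasurableSet s := by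
  obtain ⟨U, Z, hU, hZ, h⟩ := isLocallyClosed_of_locallyCompactSpace (s := s)
  exact h ▸ hU.measurableSet.inter hZ.measurableSet

/-- Confines the spectra of nearby operators to a compact part of `J`. The neighbourhood is only
relative to `J`, since `U` may contain an endpoint of `J`. -/
theorem IsCompact.exists_isCompact_isOpen_inter_subset {J U : Set ℝ} (hJ : J.OrdConnected)
    (hU : IsCompact U) (h : U ⊆ J) :
    ∃ K O : Set ℝ, IsCompact K ∧ K ⊆ J ∧ IsOpen O ∧ U ⊆ O ∧ O ∩ J ⊆ K := by
  rcases U.eq_empty_or_nonempty with rfl | hne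
  · exact ⟨∅, ∅, isCompact_empty, by simp, isOpen_empty, by simp, by simp⟩
  obtain ⟨a, ha, O₁, hO₁, hU₁, h₁⟩ : ∃ a ∈ J, ∃ O : Set ℝ, IsOpen O ∧ U ⊆ O ∧
      ∀ x ∈ O ∩ J, a ≤ x := by
    by_cases hx : ∃ x ∈ J, x < sInf U
    · obtain ⟨x, hxJ, hx⟩ := hx
      exact ⟨x, hxJ, Set.Ioi x, isOpen_Ioi, fun y hy ↦ hx.trans_le (csInf_le hU.bddBelow hy),
        fun y hy ↦ (Set.mem_Ioi.1 hy.1).le⟩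
    · push Not at hx
      exact ⟨sInf U, h (hU.sInf_mem hne), Set.univ, isOpen_univ, by simp, fun y hy ↦ hx y hy.2⟩
  obtain ⟨b, hb, O₂, hO₂, hU₂, h₂⟩ : ∃ b ∈ J, ∃ O : Set ℝ, IsOpen O ∧ U ⊆ O ∧
      ∀ x ∈ O ∩ J, x ≤ b := by
    by_cases hx : ∃ x ∈ J, sSup U < x
    · obtain ⟨x, hxJ, hx⟩ := hx
      exact ⟨x, hxJ, Set.Iio x, isOpen_Iio, fun y hy ↦ (le_csSup hU.bddAbove hy).trans_lt hx,
        fun y hy ↦ (Set.mem_Iio.1 hy.1).le⟩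
    · push Not at hx
      exact ⟨sSup U, h (hU.sSup_mem hne), Set.univ, isOpen_univ, by simp, fun y hy ↦ hx y hy.2⟩
  exact ⟨Set.Icc a b, O₁ ∩ O₂, isCompact_Icc, hJ.out ha hb, hO₁.inter hO₂,
    Set.subset_inter hU₁ hU₂, fun x hx ↦ ⟨h₁ x ⟨hx.1.1, hx.2⟩, h₂ x ⟨hx.1.2, hx.2⟩⟩⟩

/-! ### Continuity of the perspective and Jensen's inequality for integrals. -/

section Jensen

variable {H : Type u} [NormedAddCommGroup H] [InnerProductSpace ℂ H] [CompleteSpace H]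

theorem continuousOn_cfc_of_ordConnected {J : Set ℝ} (hJ : J.OrdConnected) {f : ℝ → ℝ}
    (hf : ContinuousOn f J) :
    ContinuousOn (cfc f) {X : H →L[ℂ] H | IsSelfAdjoint X ∧ spectrum ℝ X ⊆ J} := by
  intro X hX
  obtain ⟨K, O, hK, hKJ, hO, hUO, hOK⟩ := IsCompact.exists_isCompact_isOpen_inter_subset hJ
    (ContinuousFunctionalCalculus.isCompact_spectrum (R := ℝ) X) hX.2
  have hev := (upperHemicontinuous_spectrum ℝ (H →L[ℂ] H)).upperHemicontinuousAt X O
    (hO.mem_nhdsSet.2 hUO)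
  refine continuousWithinAt_id.cfc hK f hX ?_ ?_ (hf.mono hKJ)
  · filter_upwards [nhdsWithin_le_nhds hev, self_mem_nhdsWithin] with Y hY hYJ
    exact fun x hx ↦ hOK ⟨subset_of_mem_nhdsSet hY hx, hYJ.2 hx⟩
  · filter_upwards [self_mem_nhdsWithin] with Y hY using hY.1

theorem CFC.continuousOn_rpow_const (s : ℝ) :
    ContinuousOn (fun R : H →L[ℂ] H ↦ R ^ s) {R | IsStrictlyPositive R} := by
  have : ContinuousOn (fun R : H →L[ℂ] H ↦ cfc (fun x : ℝ ↦ x ^ s) R)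
      {R | IsStrictlyPositive R} := by
    refine ContinuousOn.cfc_of_mem_nhdsSet (s := Set.Ioi 0) _ ?_ continuousOn_id
      (fun R hR ↦ hR.isSelfAdjoint) (continuousOn_id.rpow_const fun x hx ↦ .inl (ne_of_gt hx))
    exact isOpen_Ioi.mem_nhdsSet.2 (Set.iUnion₂_subset fun R hR x hx ↦ hR.spectrum_pos hx)
  exact this.congr fun R hR ↦ CFC.rpow_eq_cfc_real hR.nonneg

theorem continuousOn_perspective {J : Set ℝ} (hJ : J.OrdConnected) {f : ℝ → ℝ}
    (hf : ContinuousOn f J) :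
    ContinuousOn (fun p : (H →L[ℂ] H) × (H →L[ℂ] H) ↦ perspective f p.1 p.2)
      {p | PerspectiveDomain J p.1 p.2} := by
  have hpow (s : ℝ) : ContinuousOn (fun p : (H →L[ℂ] H) × (H →L[ℂ] H) ↦ p.2 ^ s)
      {p | PerspectiveDomain J p.1 p.2} :=
    (CFC.continuousOn_rpow_const s).comp continuousOn_snd fun p hp ↦ hp.2
  have htr : ContinuousOn (fun p : (H →L[ℂ] H) × (H →L[ℂ] H) ↦ transformed p.1 p.2)
      {p | PerspectiveDomain J p.1 p.2} := ((hpow _).mul continuousOn_fst).mul (hpow _)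
  exact ((hpow _).mul ((continuousOn_cfc_of_ordConnected hJ hf).comp htr
    fun p hp ↦ ⟨isSelfAdjoint_transformed hp.1, hp.3⟩)).mul (hpow _)

theorem OperatorConvexOn.convex_epigraph_perspective {J : Set ℝ} {f : ℝ → ℝ}
    (hf : OperatorConvexOn.{u} J f) :
    Convex ℝ {q : ((H →L[ℂ] H) × (H →L[ℂ] H)) × (H →L[ℂ] H) |
      PerspectiveDomain J q.1.1 q.1.2 ∧ perspective f q.1.1 q.1.2 ≤ q.2} := by
  rw [convex_iff_forall_pos]
  rintro p ⟨hp, hpf⟩ q ⟨hq, hqf⟩ a b ha hb -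
  have hJ := hf.ordConnected
  refine ⟨(hp.smul hJ ha).add hJ (hq.smul hJ hb), ?_⟩
  refine (hf.perspective_add_le (hp.smul hJ ha) (hq.smul hJ hb)).trans ?_
  rw [perspective_smul f hp.2 ha, perspective_smul f hq.2 hb]
  exact add_le_add (smul_le_smul_of_nonneg_left hpf ha.le) (smul_le_smul_of_nonneg_left hqf hb.le)

-- The domain need not be closed, so the bound passes to the limit only at points over the domain,
-- where `g` is continuous.
open Topology in
theorem OperatorConvexOn.le_of_mem_closure_epigraph {J : Set ℝ} {f : ℝ → ℝ}
    (hf : OperatorConvexOn.{u} J f) {q : ((H →L[ℂ] H) × (H →L[ℂ] H)) × (H →L[ℂ] H)}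
    (hq : q ∈ closure {q : ((H →L[ℂ] H) × (H →L[ℂ] H)) × (H →L[ℂ] H) |
      PerspectiveDomain J q.1.1 q.1.2 ∧ perspective f q.1.1 q.1.2 ≤ q.2})
    (hdom : PerspectiveDomain J q.1.1 q.1.2) : perspective f q.1.1 q.1.2 ≤ q.2 := by
  rw [mem_closure_iff_nhdsWithin_neBot] at hq
  have h := (continuousOn_perspective hf.ordConnected hf.continuousOn).comp
    (continuousOn_fst (s := {q : ((H →L[ℂ] H) × (H →L[ℂ] H)) × (H →L[ℂ] H) |
      PerspectiveDomain J q.1.1 q.1.2})) fun q hq ↦ hq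
  have hsub : {q : ((H →L[ℂ] H) × (H →L[ℂ] H)) × (H →L[ℂ] H) |
      PerspectiveDomain J q.1.1 q.1.2 ∧ perspective f q.1.1 q.1.2 ≤ q.2} ⊆
      {q | PerspectiveDomain J q.1.1 q.1.2} := fun p hp ↦ hp.1
  refine le_of_tendsto_of_tendsto
    ((h q hdom).tendsto.mono_left (nhdsWithin_mono _ hsub))
    (continuous_snd.continuousAt.tendsto.mono_left nhdsWithin_le_nhds) ?_
  filter_upwards [self_mem_nhdsWithin] with p hp using hp.2

/-- Jensen's inequality for the perspective of an operator convex function. -/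
theorem OperatorConvexOn.perspective_setIntegral_le {J : Set ℝ} {f : ℝ → ℝ}
    (hf : OperatorConvexOn.{u} J f) {T : Type v} [TopologicalSpace T] [MeasurableSpace T]
    [BorelSpace T] {μ : Measure T} [IsFiniteMeasure μ] {S : Set T} (hS : MeasurableSet S)
    {A B : T → H →L[ℂ] H} (hAc : Continuous A) (hBc : Continuous B)
    (hdom : ∀ t, PerspectiveDomain J (A t) (B t)) (hA : Integrable A μ) (hB : Integrable B μ)
    (hg : Integrable (fun t ↦ perspective f (A t) (B t)) μ) :
    perspective f (∫ t in S, A t ∂μ) (∫ t in S, B t ∂μ) ≤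
      ∫ t in S, perspective f (A t) (B t) ∂μ := by
  by_cases hμ : μ S = 0
  · simp only [setIntegral_measure_zero _ hμ, perspective_zero, le_refl]
  have hD := PerspectiveDomain.setIntegral hf.ordConnected hS hμ hAc hBc hA hB hdom
  have hc : 0 < (μ.real S)⁻¹ := inv_pos.2 (ENNReal.toReal_pos hμ (measure_ne_top _ _))
  -- Averaging normalises the measure; homogeneity removes the factor `1 / μ S` afterwards.
  have hmem := (hf.convex_epigraph_perspective (H := H)).set_average_mem_closure
    (f := fun t ↦ ((A t, B t), perspective f (A t) (B t))) hμ (measure_ne_top _ _)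
    (ae_of_all _ fun t ↦ ⟨hdom t, le_rfl⟩) ((hA.prodMk hB).prodMk hg).integrableOn
  rw [setAverage_eq, integral_pair (hA.prodMk hB).integrableOn hg.integrableOn,
    integral_pair hA.integrableOn hB.integrableOn] at hmem
  have := hf.le_of_mem_closure_epigraph hmem (hD.smul hf.ordConnected hc)
  simp only [Prod.smul_mk, perspective_smul f hD.2 hc] at this
  have := smul_le_smul_of_nonneg_left this (inv_pos.2 hc).le
  rwa [inv_smul_smul₀ hc.ne', inv_smul_smul₀ hc.ne'] at this

end Jensen

/-! ### The two inequalities. -/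

theorem corollary2p3 {H : Type u} [NormedAddCommGroup H] [InnerProductSpace ℂ H] [CompleteSpace H]
    {T : Type v} [TopologicalSpace T] [LocallyCompactSpace T] [T2Space T]
    [MeasurableSpace T] [BorelSpace T] (μ : Measure T) [IsFiniteMeasure μ] [μ.Regular]
    (T₁ T₂ : Set T) [LocallyCompactSpace T₁] [LocallyCompactSpace T₂]
    (hdisj : Disjoint T₁ T₂) (hunion : T₁ ∪ T₂ = Set.univ)
    (J : Set ℝ) (f : ℝ → ℝ) (hf : OperatorConvexOn.{u} J f)
    (A B : T → H →L[ℂ] H) (hAc : Continuous A) (hBc : Continuous B)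
    (hdom : ∀ t, PerspectiveDomain J (A t) (B t))
    (hA : Integrable A μ) (hB : Integrable B μ)
    (hΘ : Integrable (fun t => perspective f (A t) (B t)) μ) :
    -- the pairs of integrals lie in the domain of the perspective, except over null sets
    (∀ S ∈ ({T₁, T₂, Set.univ} : Set (Set T)), μ S ≠ 0 →
      PerspectiveDomain J (∫ t in S, A t ∂μ) (∫ t in S, B t ∂μ)) ∧
    (2 : ℝ) • perspective f ((1 / 2 : ℝ) • ∫ t, A t ∂μ) ((1 / 2 : ℝ) • ∫ t, B t ∂μ) ≤
      perspective f (∫ t in T₁, A t ∂μ) (∫ t in T₁, B t ∂μ) +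
        perspective f (∫ t in T₂, A t ∂μ) (∫ t in T₂, B t ∂μ) ∧
    perspective f (∫ t in T₁, A t ∂μ) (∫ t in T₁, B t ∂μ) +
        perspective f (∫ t in T₂, A t ∂μ) (∫ t in T₂, B t ∂μ) ≤
      divergence f μ A B := by
  have hT₁ : MeasurableSet T₁ := measurableSet_of_locallyCompactSpace T₁
  have hT₂ : MeasurableSet T₂ := measurableSet_of_locallyCompactSpace T₂
  have hD {S : Set T} (hS : MeasurableSet S) (hμ : μ S ≠ 0) :=
    PerspectiveDomain.setIntegral hf.ordConnected hS hμ hAc hBc hA hB hdom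
  have hsplit {F : T → H →L[ℂ] H} (hF : Integrable F μ) :
      ∫ t, F t ∂μ = ∫ t in T₁, F t ∂μ + ∫ t in T₂, F t ∂μ := by
    rw [← setIntegral_union hdisj hT₂ hF.integrableOn hF.integrableOn, hunion, setIntegral_univ]
  refine ⟨?_, ?_, ?_⟩
  · rintro S (rfl | rfl | rfl) hμ
    exacts [hD hT₁ hμ, hD hT₂ hμ, hD .univ hμ]
  · have hhalf : (2 : ℝ) • perspective f ((1 / 2 : ℝ) • ∫ t, A t ∂μ)
        ((1 / 2 : ℝ) • ∫ t, B t ∂μ) = perspective f (∫ t, A t ∂μ) (∫ t, B t ∂μ) := by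
      by_cases hμ : μ Set.univ = 0
      · simp [Measure.measure_univ_eq_zero.1 hμ, perspective_zero]
      · have hB' := (hD .univ hμ).isStrictlyPositive
        rw [setIntegral_univ] at hB'
        rw [perspective_smul f hB' (by norm_num), smul_smul]
        norm_num
    rw [hhalf, hsplit hA, hsplit hB]
    -- A null piece gives the pair `(0, 0)`, for which domain membership is not available, so
    -- subadditivity is replaced by `perspective_zero`.
    by_cases h₁ : μ T₁ = 0
    · simp [setIntegral_measure_zero _ h₁, perspective_zero]
    by_cases h₂ : μ T₂ = 0
    · simp [setIntegral_measure_zero _ h₂, perspective_zero]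
    exact hf.perspective_add_le (hD hT₁ h₁) (hD hT₂ h₂)
  · rw [divergence, hsplit hΘ]
    exact add_le_add (hf.perspective_setIntegral_le hT₁ hAc hBc hdom hA hB hΘ)
      (hf.perspective_setIntegral_le hT₂ hAc hBc hdom hA hB hΘ)
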